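/- Let $M$ be a smooth $n$-dimensional manifold and $\tau: LM\to M$ its frame bundle, whose points are the linear isomorphisms $u:\mathbb{R}^n\to T_xM$, $x=\tau(u)\in M$, with the right action $u\cdot g=u\circ g$, $R_g(u)=u\cdot g$, of $GL(n)$. Let $\bar\theta\in\Omega^1(LM,\mathbb{R}^n)$ be the tautological form, $\bar\theta|_u(X)=u^{-1}(T_u\tau(X))$. Let $J^1LM$ be the first jet bundle, whose points are the pairs of a frame $u$ and a linear map $\rho:T_{\tau(u)}M\to T_uLM$ with $T_u\tau\circ\rho=\mathrm{id}$; let $\tau_{10}:J^1LM\to LM$, $(u,\rho)\mapsto u$, and let $GL(n)$ act on $J^1LM$ from the right by $(u,\rho)\cdot g=(u\cdot g,\,T_uR_g\circ\rho)$. Put $C(LM)=J^1LM/GL(n)$; then $\rho\mapsto([\rho],\tau_{10}(\rho))$ identifies $J^1LM$ with the pullback of $LM$ to $C(LM)$. (1) The form $\theta:=\tau_{10}^*\bar\theta$ on $J^1LM$ is a tensorial $1$-form of type $(GL(n),\mathbb{R}^n)$: it is smooth, $R_g^*\theta=g^{-1}\cdot\theta$ for all $g\in GL(n)$, and $\theta$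 vanishes on all vectors tangent to the $GL(n)$-orbits in $J^1LM$. (2) Let $\Gamma$ be a principal connection on $LM$, that is, a smooth $GL(n)$-equivariant family of linear projections $\Gamma_u:T_uLM\to T_uLM$ onto $\ker T_u\tau$. Let $\sigma_\Gamma:M\to C(LM)$ be the section with $\sigma_\Gamma(\tau(u))=[\rho]$, where $\rho$ is the jet at $u$ with $\Gamma_u=\mathrm{id}-\rho\circ T_u\tau$, and let $\tilde\sigma_\Gamma:LM\to J^1LM$ be the map $u\mapsto(\sigma_\Gamma(\tau(u)),u)$ under the above identification. Then $\tilde\sigma_\Gamma$ is smooth and $\tilde\sigma_\Gamma^*\theta=\bar\theta$. -/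

import Mathlib

open Bundle Set TopologicalSpace
open scoped Manifold ContDiff Topology

noncomputable section
set_option linter.unusedSectionVars false

section Jets

variable {EB F HB HP M P : Type*}
  [NormedAddCommGroup EB] [NormedSpace ℝ EB] [NormedAddCommGroup F] [NormedSpace ℝ F]
  [TopologicalSpace HB] [TopologicalSpace HP]
  [TopologicalSpace M] [ChartedSpace HB M] [TopologicalSpace P] [ChartedSpace HP P]
  (IB : ModelWithCorners ℝ EB HB) (IP : ModelWithCorners ℝ (EB × F) HP)

/-- The map `τ : P → M` is a smooth fibration whose total space carries charts adapted to `τ`: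
the chart at `u₀` covers the whole preimage of the chart domain at `τ u₀`, and its first component
is the chart of `M` at `τ u₀`. -/
class AdaptedCharts (τ : P → M) : Prop where
  contMDiff : ContMDiff IP IB ∞ τ
  source_eq : ∀ u₀ : P, (chartAt HP u₀).source = τ ⁻¹' (chartAt HB (τ u₀)).source
  fst_extChartAt : ∀ u₀ u : P, (extChartAt IP u₀ u).1 = extChartAt IB (τ u₀) (τ u)

/-- A point of the first jet bundle `J¹P` of `τ : P → M`: a point `p` of `P` and a linear map
`ρ : T_{τ p} M → T_p P` such that `T_p τ ∘ ρ = id`. -/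
@[ext]
structure Jet (τ : P → M) where
  point : P
  lift : TangentSpace IB (τ point) →L[ℝ] TangentSpace IP point
  comp_lift : (mfderiv IP IB τ point).comp lift = ContinuousLinearMap.id ℝ _

variable {IB IP} {τ : P → M} [hτ : AdaptedCharts IB IP τ]

theorem AdaptedCharts.hasMFDerivAt (u : P) : HasMFDerivAt IP IB τ u
    (ContinuousLinearMap.fst ℝ EB F : EB × F →L[ℝ] EB) := by
  refine ⟨(hτ.contMDiff u).continuousAt, ?_⟩
  refine (hasFDerivWithinAt_fst (𝕜 := ℝ)).congr_of_eventuallyEq ?_ ?_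
  · filter_upwards [extChartAt_target_mem_nhdsWithin (I := IP) u] with y hy
    simp only [writtenInExtChartAt, Function.comp_apply]
    rw [← hτ.fst_extChartAt, (extChartAt IP u).right_inv hy]
  · simp only [writtenInExtChartAt, Function.comp_apply]
    rw [← hτ.fst_extChartAt, (extChartAt IP u).right_inv (mem_extChartAt_target u)]

/-- In adapted charts, `T τ` is the first projection. -/
theorem AdaptedCharts.mfderiv_eq_fst (u : P) :
    mfderiv IP IB τ u = (ContinuousLinearMap.fst ℝ EB F : EB × F →L[ℝ] EB) :=
  (AdaptedCharts.hasMFDerivAt u).mfderiv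

theorem AdaptedCharts.mem_source {u₀ u : P} :
    u ∈ (extChartAt IP u₀).source ↔ τ u ∈ (extChartAt IB (τ u₀)).source := by
  rw [extChartAt_source, extChartAt_source, hτ.source_eq, mem_preimage]

variable [IsManifold IB ∞ M] [IsManifold IP ∞ P] [IB.Boundaryless] [IP.Boundaryless]

theorem AdaptedCharts.fst_tangentCoordChange {a b u : P} (ha : u ∈ (extChartAt IP a).source)
    (hb : u ∈ (extChartAt IP b).source) (w : EB × F) :
    (tangentCoordChange IP a b u w).1 = tangentCoordChange IB (τ a) (τ b) (τ u) w.1 := by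
  have hP : HasFDerivAt (extChartAt IP b ∘ (extChartAt IP a).symm)
      (tangentCoordChange IP a b u) (extChartAt IP a u) := by
    have := hasFDerivWithinAt_tangentCoordChange (I := IP) (x := a) (y := b) ⟨ha, hb⟩
    rwa [IP.range_eq_univ, hasFDerivWithinAt_univ] at this
  have hB : HasFDerivAt (extChartAt IB (τ b) ∘ (extChartAt IB (τ a)).symm)
      (tangentCoordChange IB (τ a) (τ b) (τ u)) (extChartAt IP a u).1 := by
    have := hasFDerivWithinAt_tangentCoordChange (I := IB) (x := τ a) (y := τ b)
      ⟨AdaptedCharts.mem_source.1 ha, AdaptedCharts.mem_source.1 hb⟩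
    rwa [IB.range_eq_univ, hasFDerivWithinAt_univ, ← hτ.fst_extChartAt] at this
  have h1 := (hasFDerivAt_fst (𝕜 := ℝ) (E := EB) (F := F)).comp _ hP
  have h2 := hB.comp (extChartAt IP a u) (hasFDerivAt_fst (𝕜 := ℝ) (E := EB) (F := F))
  have h3 : (Prod.fst : EB × F → EB) ∘ extChartAt IP b ∘ (extChartAt IP a).symm
      =ᶠ[𝓝 (extChartAt IP a u)]
      (extChartAt IB (τ b) ∘ (extChartAt IB (τ a)).symm) ∘ Prod.fst := by
    filter_upwards [(isOpen_extChartAt_target a).mem_nhds ((extChartAt IP a).map_source ha)]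
      with y hy
    have hs := (extChartAt IP a).map_target hy
    simp only [Function.comp_apply]
    conv_rhs => rw [← (extChartAt IP a).right_inv hy]
    rw [hτ.fst_extChartAt, hτ.fst_extChartAt,
      (extChartAt IB (τ a)).left_inv (AdaptedCharts.mem_source.1 hs)]
  exact DFunLike.congr_fun (h1.unique (h2.congr_of_eventuallyEq h3)) w

variable (IB IP τ) in
/-- The coordinate of a jet `ρ` at `u` in the adapted charts around `u₀`: the second component of
`T_u(chart) ∘ ρ ∘ T(chart of M)⁻¹`. -/
def jetCoord (u₀ u : P) (ρ : EB →L[ℝ] EB × F) : EB →L[ℝ] F :=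
  (ContinuousLinearMap.snd ℝ EB F).comp ((tangentCoordChange IP u u₀ u).comp
    (ρ.comp (tangentCoordChange IB (τ u₀) (τ u) (τ u))))

variable (IB IP τ) in
/-- The jet at `u` with coordinate `A` in the adapted charts around `u₀`. -/
def jetOfCoord (u₀ u : P) (A : EB →L[ℝ] F) : EB →L[ℝ] EB × F :=
  (tangentCoordChange IP u₀ u u).comp
    (((ContinuousLinearMap.id ℝ EB).prod A).comp (tangentCoordChange IB (τ u) (τ u₀) (τ u)))

theorem tangentCoordChange_symm {a b x : M} (ha : x ∈ (extChartAt IB a).source)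
    (hb : x ∈ (extChartAt IB b).source) (v : EB) :
    tangentCoordChange IB b a x (tangentCoordChange IB a b x v) = v := by
  rw [tangentCoordChange_comp ⟨⟨ha, hb⟩, ha⟩, tangentCoordChange_self ha]

theorem comp_jetOfCoord {u₀ u : P} (hu : u ∈ (extChartAt IP u₀).source) (A : EB →L[ℝ] F) :
    (mfderiv IP IB τ u : EB × F →L[ℝ] EB).comp (jetOfCoord IB IP τ u₀ u A) =
      ContinuousLinearMap.id ℝ EB := by
  rw [AdaptedCharts.mfderiv_eq_fst]
  ext v : 1
  change (tangentCoordChange IP u₀ u u (_, _)).1 = v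
  rw [AdaptedCharts.fst_tangentCoordChange (IB := IB) (τ := τ) hu (mem_extChartAt_source u)]
  exact tangentCoordChange_symm (mem_extChartAt_source _) (AdaptedCharts.mem_source.1 hu) v

theorem jetCoord_jetOfCoord {a b u : P} (ha : u ∈ (extChartAt IP a).source)
    (hb : u ∈ (extChartAt IP b).source) (A : EB →L[ℝ] F) :
    jetCoord IB IP τ b u (jetOfCoord IB IP τ a u A) =
      (ContinuousLinearMap.snd ℝ EB F).comp ((tangentCoordChange IP a b u).comp
        (((ContinuousLinearMap.id ℝ EB).prod A).comp
          (tangentCoordChange IB (τ b) (τ a) (τ u)))) := by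
  ext v : 1
  simp only [jetCoord, jetOfCoord, ContinuousLinearMap.comp_apply]
  rw [tangentCoordChange_comp ⟨⟨ha, mem_extChartAt_source u⟩, hb⟩,
    tangentCoordChange_comp ⟨⟨AdaptedCharts.mem_source.1 hb, mem_extChartAt_source _⟩,
      AdaptedCharts.mem_source.1 ha⟩]

theorem jetCoord_jetOfCoord_self {a u : P} (ha : u ∈ (extChartAt IP a).source)
    (A : EB →L[ℝ] F) : jetCoord IB IP τ a u (jetOfCoord IB IP τ a u A) = A := by
  rw [jetCoord_jetOfCoord ha ha]
  ext v : 1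
  change (tangentCoordChange IP a a u (_, _)).2 = _
  rw [tangentCoordChange_self ha]
  exact congrArg A (tangentCoordChange_self (AdaptedCharts.mem_source.1 ha))

theorem jetOfCoord_jetCoord {a u : P} (ha : u ∈ (extChartAt IP a).source)
    {ρ : EB →L[ℝ] EB × F}
    (h : (mfderiv IP IB τ u : EB × F →L[ℝ] EB).comp ρ = ContinuousLinearMap.id ℝ EB) :
    jetOfCoord IB IP τ a u (jetCoord IB IP τ a u ρ) = ρ := by
  rw [AdaptedCharts.mfderiv_eq_fst] at h
  have h' : ∀ v, (ρ v).1 = v := fun v => DFunLike.congr_fun h v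
  have ha' := AdaptedCharts.mem_source (IB := IB) (τ := τ).1 ha
  ext v : 1
  have : ((ContinuousLinearMap.id ℝ EB).prod (jetCoord IB IP τ a u ρ))
      (tangentCoordChange IB (τ u) (τ a) (τ u) v) = tangentCoordChange IP u a u (ρ v) := by
    refine Prod.ext ?_ ?_
    · rw [AdaptedCharts.fst_tangentCoordChange (IB := IB) (τ := τ) (mem_extChartAt_source u) ha, h']
      rfl
    · exact congrArg (fun w => (tangentCoordChange IP u a u (ρ w)).2)
        (tangentCoordChange_symm (mem_extChartAt_source _) ha' v)
  exact (congrArg (tangentCoordChange IP a u u) this).trans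
    (tangentCoordChange_symm (mem_extChartAt_source u) ha _)

variable (IB IP τ) in
open Classical in
/-- The base point of the inverse of the chart of `P` at `u₀`, extended by `u₀` outside of the
chart target. -/
def chartPoint (u₀ : P) (y : EB × F) : P :=
  if y ∈ (extChartAt IP u₀).target then (extChartAt IP u₀).symm y else u₀

theorem chartPoint_of_mem {u₀ : P} {y : EB × F} (hy : y ∈ (extChartAt IP u₀).target) :
    chartPoint IP u₀ y = (extChartAt IP u₀).symm y := if_pos hy

theorem chartPoint_mem (u₀ : P) (y : EB × F) :
    chartPoint IP u₀ y ∈ (extChartAt IP u₀).source := by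
  unfold chartPoint
  split_ifs with h
  · exact (extChartAt IP u₀).map_target h
  · exact mem_extChartAt_source u₀

/-- The jet with base point `u` and lift `ρ`, in terms of the model vector spaces. -/
def Jet.ofModel (u : P) (ρ : EB →L[ℝ] EB × F)
    (h : (mfderiv IP IB τ u : EB × F →L[ℝ] EB).comp ρ = ContinuousLinearMap.id ℝ EB) :
    Jet IB IP τ := ⟨u, ρ, h⟩

theorem Jet.ofModel_congr {u u' : P} {ρ ρ' : EB →L[ℝ] EB × F} {h h'} (hu : u = u')
    (hρ : ρ = ρ') : Jet.ofModel (τ := τ) (IB := IB) (IP := IP) u ρ h = Jet.ofModel u' ρ' h' := by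
  subst hu hρ; rfl

theorem ofModel_chartPoint {u₀ u : P} (hu : u ∈ (extChartAt IP u₀).source)
    (ρ : EB →L[ℝ] EB × F)
    (h : (mfderiv IP IB τ u : EB × F →L[ℝ] EB).comp ρ = ContinuousLinearMap.id ℝ EB) :
    (Jet.ofModel (chartPoint IP u₀ (extChartAt IP u₀ u))
      (jetOfCoord IB IP τ u₀ (chartPoint IP u₀ (extChartAt IP u₀ u))
        (jetCoord IB IP τ u₀ u ρ)) (comp_jetOfCoord (chartPoint_mem _ _) _) : Jet IB IP τ) =
      Jet.ofModel u ρ h := by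
  have e : chartPoint IP u₀ (extChartAt IP u₀ u) = u := by
    rw [chartPoint_of_mem ((extChartAt IP u₀).map_source hu), (extChartAt IP u₀).left_inv hu]
  refine Jet.ofModel_congr e ?_
  rw [e]
  exact jetOfCoord_jetCoord hu h

variable (IB IP τ) in
/-- The adapted chart of `J¹P` over the chart of `P` at `u₀`: a jet `ρ` at `u` is sent to the
coordinates of `u` together with the second component of `T(chart) ∘ ρ ∘ T(chart of M)⁻¹`. -/
def jetChart (u₀ : P) : PartialEquiv (Jet IB IP τ) ((EB × F) × (EB →L[ℝ] F)) where
  source := Jet.point ⁻¹' (extChartAt IP u₀).source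
  target := (extChartAt IP u₀).target ×ˢ univ
  toFun j := (extChartAt IP u₀ j.point, jetCoord IB IP τ u₀ j.point j.lift)
  invFun q := Jet.ofModel (chartPoint IP u₀ q.1)
    (jetOfCoord IB IP τ u₀ (chartPoint IP u₀ q.1) q.2) (comp_jetOfCoord (chartPoint_mem _ _) q.2)
  map_source' j hj := ⟨(extChartAt IP u₀).map_source hj, mem_univ _⟩
  map_target' q hq := chartPoint_mem u₀ q.1
  left_inv' j hj := by
    obtain ⟨u, ρ, h⟩ := j
    exact ofModel_chartPoint hj ρ h
  right_inv' q hq := by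
    refine Prod.ext ?_ (jetCoord_jetOfCoord_self (chartPoint_mem u₀ q.1) q.2)
    change extChartAt IP u₀ (chartPoint IP u₀ q.1) = q.1
    rw [chartPoint_of_mem hq.1, (extChartAt IP u₀).right_inv hq.1]

theorem jetChart_transition_source (a b : P) :
    ((jetChart IB IP τ a).symm.trans (jetChart IB IP τ b)).source =
      ((extChartAt IP a).symm.trans (extChartAt IP b)).source ×ˢ univ := by
  ext ⟨y, A⟩
  simp only [PartialEquiv.trans_source, PartialEquiv.symm_source, mem_inter_iff, mem_preimage,
    mem_prod, mem_univ, and_true]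
  change ((y ∈ (extChartAt IP a).target ∧ True) ∧ chartPoint IP a y ∈ (extChartAt IP b).source) ↔ _
  rw [and_true]
  refine and_congr_right fun hy => ?_
  rw [chartPoint_of_mem hy]

theorem isOpen_extChartAt_transition_source (a b : P) :
    IsOpen ((extChartAt IP a).symm.trans (extChartAt IP b)).source := by
  rw [PartialEquiv.trans_source, PartialEquiv.symm_source]
  exact (continuousOn_extChartAt_symm a).isOpen_inter_preimage (isOpen_extChartAt_target a)
    (isOpen_extChartAt_source b)

theorem tangentCoordChange_eq_fderiv {a b x : M} :
    tangentCoordChange IB a b x =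
      fderiv ℝ (extChartAt IB b ∘ (extChartAt IB a).symm) (extChartAt IB a x) := by
  rw [tangentCoordChange_def, IB.range_eq_univ, fderivWithin_univ]

theorem jetChart_transition (a b : P) {q : (EB × F) × (EB →L[ℝ] F)}
    (hq : q ∈ ((extChartAt IP a).symm.trans (extChartAt IP b)).source ×ˢ (univ : Set (EB →L[ℝ] F))) :
    (jetChart IB IP τ a).symm.trans (jetChart IB IP τ b) q =
      (extChartAt IP b ((extChartAt IP a).symm q.1),
        (ContinuousLinearMap.snd ℝ EB F).comp
          ((fderiv ℝ (extChartAt IP b ∘ (extChartAt IP a).symm) q.1).comp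
          (((ContinuousLinearMap.id ℝ EB).prod q.2).comp
          (fderiv ℝ (extChartAt IB (τ a) ∘ (extChartAt IB (τ b)).symm)
            (extChartAt IP b ((extChartAt IP a).symm q.1)).1)))) := by
  obtain ⟨y, A⟩ := q
  have hy : y ∈ (extChartAt IP a).target := hq.1.1
  have hb : (extChartAt IP a).symm y ∈ (extChartAt IP b).source := hq.1.2
  have e := chartPoint_of_mem hy
  change (extChartAt IP b (chartPoint IP a y),
    jetCoord IB IP τ b (chartPoint IP a y) (jetOfCoord IB IP τ a (chartPoint IP a y) A)) = _
  rw [jetCoord_jetOfCoord (chartPoint_mem a y) (e ▸ hb), e, tangentCoordChange_eq_fderiv,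
    tangentCoordChange_eq_fderiv, (extChartAt IP a).right_inv hy, hτ.fst_extChartAt]

theorem contDiffOn_fderiv_transition (a b : M) :
    ContDiffOn ℝ ∞ (fderiv ℝ (extChartAt IB b ∘ (extChartAt IB a).symm))
      ((extChartAt IB a).symm.trans (extChartAt IB b)).source := by
  have : IsManifold IB (∞ + 1) M := ‹IsManifold IB ∞ M›
  have h := contDiffOn_fderiv_coord_change (I := IB) (n := ∞) (achart HB a) (achart HB b)
  rw [IB.range_eq_univ, fderivWithin_univ] at h
  exact h

theorem contDiffOn_jetChart_transition (a b : P) :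
    ContDiffOn ℝ ∞ ((jetChart IB IP τ a).symm.trans (jetChart IB IP τ b))
      ((jetChart IB IP τ a).symm.trans (jetChart IB IP τ b)).source := by
  rw [jetChart_transition_source]
  refine ContDiffOn.congr ?_ fun q hq => jetChart_transition a b hq
  have h0 : ContDiffOn ℝ ∞ (fun q : (EB × F) × (EB →L[ℝ] F) =>
      extChartAt IP b ((extChartAt IP a).symm q.1))
      (((extChartAt IP a).symm.trans (extChartAt IP b)).source ×ˢ univ) :=
    (contDiffOn_ext_coord_change (I := IP) (n := ∞) b a).comp contDiffOn_fst fun q hq => hq.1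
  refine h0.prodMk ?_
  refine contDiffOn_const.clm_comp (ContDiffOn.clm_comp ?_ (ContDiffOn.clm_comp ?_ ?_))
  · exact (contDiffOn_fderiv_transition a b).comp contDiffOn_fst fun q hq => hq.1
  · exact (ContinuousLinearMap.prodₗᵢ (𝕜 := ℝ) (E := EB) (F := EB) (G := F) ℝ).contDiff.comp_contDiffOn
      (contDiffOn_const.prodMk contDiffOn_snd)
  · refine (contDiffOn_fderiv_transition (τ b) (τ a)).comp
      (contDiff_fst.comp_contDiffOn h0) fun q hq => ?_
    have hb : (extChartAt IP a).symm q.1 ∈ (extChartAt IP b).source := hq.1.2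
    have ha : (extChartAt IP a).symm q.1 ∈ (extChartAt IP a).source :=
      (extChartAt IP a).map_target hq.1.1
    have hb' := AdaptedCharts.mem_source (IB := IB) (τ := τ).1 hb
    change (extChartAt IP b ((extChartAt IP a).symm q.1)).1 ∈ _
    rw [hτ.fst_extChartAt]
    refine ⟨(extChartAt IB (τ b)).map_source hb', ?_⟩
    change (extChartAt IB (τ b)).symm _ ∈ (extChartAt IB (τ a)).source
    rw [(extChartAt IB (τ b)).left_inv hb']
    exact AdaptedCharts.mem_source.1 ha

variable (IB IP τ) in
/-- The smooth atlas of adapted charts of `J¹P`. -/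
def jetChartedSpaceCore :
    ChartedSpaceCore ((EB × F) × (EB →L[ℝ] F)) (Jet IB IP τ) where
  atlas := range (jetChart IB IP τ)
  chartAt j := jetChart IB IP τ j.point
  mem_chart_source j := mem_extChartAt_source j.point
  chart_mem_atlas j := mem_range_self _
  open_source := by
    rintro _ _ ⟨a, rfl⟩ ⟨b, rfl⟩
    rw [jetChart_transition_source]
    exact (isOpen_extChartAt_transition_source a b).prod isOpen_univ
  continuousOn_toFun := by
    rintro _ _ ⟨a, rfl⟩ ⟨b, rfl⟩
    exact (contDiffOn_jetChart_transition a b).continuousOn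

instance : TopologicalSpace (Jet IB IP τ) := (jetChartedSpaceCore IB IP τ).toTopologicalSpace

instance : ChartedSpace ((EB × F) × (EB →L[ℝ] F)) (Jet IB IP τ) :=
  (jetChartedSpaceCore IB IP τ).toChartedSpace

theorem mem_jetAtlas {e : OpenPartialHomeomorph (Jet IB IP τ) ((EB × F) × (EB →L[ℝ] F))}
    (he : e ∈ atlas ((EB × F) × (EB →L[ℝ] F)) (Jet IB IP τ)) :
    ∃ f, ∃ hf : f ∈ (jetChartedSpaceCore IB IP τ).atlas,
      e = (jetChartedSpaceCore IB IP τ).openPartialHomeomorph f hf := by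
  change e ∈ ⋃ (f : PartialEquiv _ _) (hf : f ∈ (jetChartedSpaceCore IB IP τ).atlas),
    {(jetChartedSpaceCore IB IP τ).openPartialHomeomorph f hf} at he
  simpa only [mem_iUnion, mem_singleton_iff] using he

instance : IsManifold 𝓘(ℝ, (EB × F) × (EB →L[ℝ] F)) ∞ (Jet IB IP τ) := by
  refine isManifold_of_contDiffOn _ _ _ ?_
  intro e e' he he'
  obtain ⟨f, ⟨a, rfl⟩, rfl⟩ : ∃ f, ∃ hf : f ∈ (jetChartedSpaceCore IB IP τ).atlas,
      e = (jetChartedSpaceCore IB IP τ).openPartialHomeomorph f hf := by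
    exact mem_jetAtlas he
  obtain ⟨f', ⟨b, rfl⟩, rfl⟩ : ∃ f, ∃ hf : f ∈ (jetChartedSpaceCore IB IP τ).atlas,
      e' = (jetChartedSpaceCore IB IP τ).openPartialHomeomorph f hf := by
    exact mem_jetAtlas he'
  refine (contDiffOn_jetChart_transition a b).mono ?_
  exact inter_subset_left

end Jets
/-- The model space `ℝⁿ`. -/
abbrev RVec (n : ℕ) : Type := EuclideanSpace ℝ (Fin n)

/-- The general linear group `GL(n)` of `ℝⁿ`: the units of the endomorphism algebra, with
Mathlib's Lie group structure. -/
abbrev GLn (n : ℕ) : Type := (RVec n →L[ℝ] RVec n)ˣ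

section FrameBundle

variable (n : ℕ) (M : Type*) [TopologicalSpace M] [ChartedSpace (RVec n) M]
  [IsManifold (𝓡 n) ∞ M]

/-- The total space of the smooth vector bundle `Hom(ℝⁿ, TM) → M`. -/
abbrev HomTangent : Type _ :=
  TotalSpace (RVec n →L[ℝ] RVec n)
    (fun x : M => Bundle.Trivial M (RVec n) x →L[ℝ] TangentSpace (𝓡 n) x)

theorem isOpen_setOf_isInvertible :
    IsOpen {u : HomTangent n M | u.2.IsInvertible} := by
  rw [isOpen_iff_mem_nhds]
  intro u₀ hu₀
  set e := trivializationAt (RVec n →L[ℝ] RVec n)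
    (fun x : M => Bundle.Trivial M (RVec n) x →L[ℝ] TangentSpace (𝓡 n) x) u₀.1 with he
  have key : ∀ u ∈ e.source, (u.2.IsInvertible ↔
      (e u).2 ∈ range ((↑) : (RVec n ≃L[ℝ] RVec n) → (RVec n →L[ℝ] RVec n))) := by
    intro u hu
    have hu' : u.1 ∈ (trivializationAt (RVec n) (Bundle.Trivial M (RVec n)) u₀.1).baseSet ∩
      (trivializationAt (RVec n) (TangentSpace (𝓡 n)) u₀.1).baseSet := hu
    rw [he, hom_trivializationAt_apply]
    dsimp only
    rw [ContinuousLinearMap.inCoordinates_eq hu'.1 hu'.2]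
    change _ ↔ ContinuousLinearMap.IsInvertible _
    rw [ContinuousLinearMap.isInvertible_equiv_comp, ContinuousLinearMap.isInvertible_comp_equiv]
  have hopen : IsOpen (e.source ∩ e ⁻¹' (univ ×ˢ
      range ((↑) : (RVec n ≃L[ℝ] RVec n) → (RVec n →L[ℝ] RVec n)))) :=
    e.continuousOn.isOpen_inter_preimage e.open_source
      (isOpen_univ.prod ContinuousLinearEquiv.isOpen)
  have hmem : u₀ ∈ e.source := FiberBundle.mem_trivializationAt_proj_source
  refine Filter.mem_of_superset
    (hopen.mem_nhds ⟨hmem, mem_univ _, (key u₀ hmem).1 hu₀⟩) ?_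
  rintro u ⟨hu, -, hr⟩
  exact (key u hu).2 hr

/-- The open subset of `Hom(ℝⁿ, TM)` of the linear isomorphisms. -/
def frameOpens : Opens (HomTangent n M) :=
  ⟨{u | u.2.IsInvertible}, isOpen_setOf_isInvertible n M⟩

/-- The frame bundle `LM`: its points are the pairs of a point `x` of `M` and a linear isomorphism
`u : ℝⁿ → T_x M`, with the manifold structure of open subset of `Hom(ℝⁿ, TM)`. -/
def FrameBundle : Type _ := frameOpens n M

instance : TopologicalSpace (FrameBundle n M) :=
  inferInstanceAs (TopologicalSpace (frameOpens n M))

instance : ChartedSpace (ModelProd (RVec n) (RVec n →L[ℝ] RVec n)) (FrameBundle n M) :=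
  inferInstanceAs (ChartedSpace (ModelProd (RVec n) (RVec n →L[ℝ] RVec n)) (frameOpens n M))

/-- The model with corners (without boundary) of the frame bundle. -/
abbrev frameModel : ModelWithCorners ℝ (RVec n × (RVec n →L[ℝ] RVec n))
    (ModelProd (RVec n) (RVec n →L[ℝ] RVec n)) := (𝓡 n).prod 𝓘(ℝ, RVec n →L[ℝ] RVec n)

instance : IsManifold (frameModel n) ∞ (FrameBundle n M) :=
  inferInstanceAs (IsManifold (frameModel n) ∞ (frameOpens n M))

variable {n M}

namespace FrameBundle

/-- The projection `τ : LM → M`. -/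
def proj (u : FrameBundle n M) : M := u.1.1

/-- The linear isomorphism `ℝⁿ → T_x M` given by a frame at `x`. -/
def toHom (u : FrameBundle n M) : RVec n →L[ℝ] TangentSpace (𝓡 n) u.proj := u.1.2

theorem isInvertible_toHom (u : FrameBundle n M) : u.toHom.IsInvertible := u.2

/-- The frame at `x` given by a linear isomorphism `ℝⁿ → T_x M`. -/
def mk (x : M) (f : RVec n →L[ℝ] TangentSpace (𝓡 n) x) (hf : f.IsInvertible) :
    FrameBundle n M := ⟨⟨x, f⟩, hf⟩

/-- The right action of `GL(n)` on `LM`: `u · g = u ∘ g`. -/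
def act (u : FrameBundle n M) (g : GLn n) : FrameBundle n M :=
  mk u.proj (u.toHom.comp (g : RVec n →L[ℝ] RVec n))
    (u.isInvertible_toHom.comp ⟨ContinuousLinearEquiv.unitsEquiv ℝ (RVec n) g, rfl⟩)

theorem contMDiff_proj : ContMDiff (frameModel n) (𝓡 n) ∞ (proj : FrameBundle n M → M) :=
  (Bundle.contMDiff_proj (fun x : M => Bundle.Trivial M (RVec n) x →L[ℝ] TangentSpace (𝓡 n) x)
    (n := ∞) (IB := 𝓡 n)).comp
    (contMDiff_subtype_val (I := frameModel n) (U := frameOpens n M) (n := ∞))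

instance : AdaptedCharts (𝓡 n) (frameModel n) (proj : FrameBundle n M → M) where
  contMDiff := contMDiff_proj
  source_eq u₀ := by
    ext u
    change u ∈ ((chartAt (ModelProd (RVec n) (RVec n →L[ℝ] RVec n))
      (u₀.1 : HomTangent n M)).subtypeRestr ⟨u₀⟩).source ↔ _
    rw [OpenPartialHomeomorph.subtypeRestr_source]
    simp only [FiberBundle.chartedSpace_chartAt, mfld_simps]
    exact ⟨fun h => h.1.2, fun h => ⟨⟨mem_univ _, h⟩, h, mem_univ _⟩⟩
  fst_extChartAt u₀ u := rfl

theorem contMDiff_act (g : GLn n) : ContMDiff (frameModel n) (frameModel n) ∞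
    (fun u : FrameBundle n M => u.act g) := by
  have h : ContMDiff (frameModel n) (frameModel n) ∞ (fun u : FrameBundle n M => (u.1 : HomTangent n M)) :=
    contMDiff_subtype_val (I := frameModel n) (U := frameOpens n M) (n := ∞)
  refine (ContMDiff.subtypeVal_comp_iff (frameOpens n M) (fun u : FrameBundle n M => u.act g)).1 ?_
  intro u₀
  have h0 := (contMDiffAt_hom_bundle _).1 (h u₀)
  refine (contMDiffAt_hom_bundle _).2 ⟨h0.1, ?_⟩
  refine (h0.2.clm_comp (contMDiffAt_const (c := (g : RVec n →L[ℝ] RVec n)))).congr_of_eventuallyEq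
    (.of_forall fun u => ?_)
  have e (x₀ x : M) : (trivializationAt (RVec n) (Bundle.Trivial M (RVec n)) x₀).symmL ℝ x =
      ContinuousLinearMap.id ℝ (RVec n) := Bundle.Trivial.symmL_trivialization ℝ M (RVec n) x
  simp only [ContinuousLinearMap.inCoordinates]
  rw [e, e]
  rfl

/-- The tautological form `θ̄` of `LM`: `θ̄|_u (X) = u⁻¹ (T_u τ (X))`. -/
def tautologicalForm (u : FrameBundle n M) :
    TangentSpace (frameModel n) u →L[ℝ] RVec n :=
  u.toHom.inverse.comp (mfderiv (frameModel n) (𝓡 n) proj u)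

end FrameBundle
end FrameBundle
section OneForms

variable {E H P V : Type*} [NormedAddCommGroup E] [NormedSpace ℝ E] [TopologicalSpace H]
  [TopologicalSpace P] [ChartedSpace H P] [NormedAddCommGroup V] [NormedSpace ℝ V]
  {E' H' P' : Type*} [NormedAddCommGroup E'] [NormedSpace ℝ E'] [TopologicalSpace H']
  [TopologicalSpace P'] [ChartedSpace H' P']
  {EG HG G : Type*} [NormedAddCommGroup EG] [NormedSpace ℝ EG] [TopologicalSpace HG]
  [TopologicalSpace G] [ChartedSpace HG G] [Group G]

/-- The pullback `f^*α` of a `V`-valued 1-form along a map `f`. -/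
def pullbackOneForm (I : ModelWithCorners ℝ E H) (I' : ModelWithCorners ℝ E' H') (f : P → P')
    (α : ∀ q : P', TangentSpace I' q →L[ℝ] V) (p : P) : TangentSpace I p →L[ℝ] V :=
  (α (f p)).comp (mfderiv I I' f p)

/-- A `V`-valued 1-form `α` on a manifold `P` with a right action of a Lie group `G` is tensorial
of type `(G, V)`, with respect to a representation of `G` on `V`, if it is smooth, if
`R_g^* α = g⁻¹ · α` for all `g` (that is, `α` is pseudotensorial), and if it vanishes on the
vertical vectors, that is, on the vectors that are tangent to the orbits of `G`. -/
structure IsTensorialOneForm (IG : ModelWithCorners ℝ EG HG) (I : ModelWithCorners ℝ E H)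
    [IsManifold I 1 P] (act : P → G → P) (rep : G →* (V →L[ℝ] V))
    (α : ∀ p : P, TangentSpace I p →L[ℝ] V) : Prop where
  smooth : ContMDiff I.tangent 𝓘(ℝ, V) ∞ (fun Z : TangentBundle I P => α Z.1 Z.2)
  pseudotensorial : ∀ (g : G) (p : P),
    pullbackOneForm I I (fun q => act q g) α p = (rep g⁻¹).comp (α p)
  horizontal : ∀ (p : P) (g : G) (ξ : TangentSpace IG g),
    α (act p g) (mfderiv IG I (fun h : G => act p h) g ξ) = 0

end OneForms

section Linear

variable {B X : Type*} [NormedAddCommGroup B] [NormedSpace ℝ B] [NormedAddCommGroup X]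
  [NormedSpace ℝ X]

theorem exists_lift_of_projection (T : X →L[ℝ] B) (A : X →L[ℝ] X) (ι : B →L[ℝ] X)
    (hA : ∀ Y, T (A Y) = 0) (hA' : ∀ Y, T Y = 0 → A Y = Y) (hι : ∀ v, T (ι v) = v) :
    ∃ ρ : B →L[ℝ] X, T.comp ρ = ContinuousLinearMap.id ℝ B ∧ ∀ Y, A Y = Y - ρ (T Y) := by
  refine ⟨ι - A.comp ι, ?_, fun Y => ?_⟩
  · ext v : 1
    simp [hA, hι]
  · have h1 : A (Y - ι (T Y)) = Y - ι (T Y) := hA' _ (by simp [hι])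
    rw [map_sub, sub_eq_iff_eq_add] at h1
    rw [h1]
    simp only [sub_apply, ContinuousLinearMap.comp_apply]
    abel

theorem lift_eq_of_equivariant (T T' : X →L[ℝ] B) (A A' : X →L[ℝ] X) (ρ ρ' : B →L[ℝ] X)
    (R : X →L[ℝ] X) (hρ : T.comp ρ = ContinuousLinearMap.id ℝ B)
    (hA : ∀ Y, A Y = Y - ρ (T Y)) (hA' : ∀ Y, A' Y = Y - ρ' (T' Y)) (hR : T'.comp R = T)
    (h : A'.comp R = R.comp A) : R.comp ρ = ρ' := by
  ext v : 1
  have hv : T (ρ v) = v := DFunLike.congr_fun hρ v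
  have h1 : T' (R (ρ v)) = v := (DFunLike.congr_fun hR (ρ v)).trans hv
  have h2 : A' (R (ρ v)) = R (A (ρ v)) := DFunLike.congr_fun h (ρ v)
  rw [hA, hA', h1, hv, sub_self, map_zero, sub_eq_zero] at h2
  exact h2

end Linear

section JetFrameBundle

variable (n : ℕ) (M : Type*) [TopologicalSpace M] [ChartedSpace (RVec n) M]
  [IsManifold (𝓡 n) ∞ M]

/-- The first jet bundle `J¹LM` of the frame bundle. -/
abbrev JetFrame : Type _ :=
  Jet (𝓡 n) (frameModel n) (FrameBundle.proj : FrameBundle n M → M)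

/-- The model with corners (without boundary) of `J¹LM`. -/
abbrev jetFrameModel : ModelWithCorners ℝ
    ((RVec n × (RVec n →L[ℝ] RVec n)) × (RVec n →L[ℝ] (RVec n →L[ℝ] RVec n)))
    ((RVec n × (RVec n →L[ℝ] RVec n)) × (RVec n →L[ℝ] (RVec n →L[ℝ] RVec n))) :=
  𝓘(ℝ, (RVec n × (RVec n →L[ℝ] RVec n)) × (RVec n →L[ℝ] (RVec n →L[ℝ] RVec n)))

instance : IsManifold (jetFrameModel n) 1 (JetFrame n M) :=
  .of_le (n := ∞) (by simp)

variable {n M}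

/-- The derivative of the right translation of `LM` by `g`. -/
abbrev FrameBundle.dAct (g : GLn n) (u : FrameBundle n M) :
    TangentSpace (frameModel n) u →L[ℝ] TangentSpace (frameModel n) (u.act g) :=
  mfderiv (frameModel n) (frameModel n) (fun v : FrameBundle n M => v.act g) u

theorem FrameBundle.dproj_comp_dAct (g : GLn n) (u : FrameBundle n M) :
    (mfderiv (frameModel n) (𝓡 n) FrameBundle.proj (u.act g)).comp (FrameBundle.dAct g u) =
      mfderiv (frameModel n) (𝓡 n) FrameBundle.proj u := by
  rw [← mfderiv_comp u (FrameBundle.contMDiff_proj.mdifferentiableAt (by simp))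
    ((FrameBundle.contMDiff_act g).mdifferentiableAt (by simp))]
  rfl

namespace JetFrame

/-- The projection `τ₁₀ : J¹LM → LM`. -/
def toFrame (j : JetFrame n M) : FrameBundle n M := j.point

/-- The projection `τ₁ : J¹LM → M`. -/
def base (j : JetFrame n M) : M := j.point.proj

/-- The right action of `GL(n)` on `J¹LM`, the lift of the action on `LM`:
`ρ · g = T R_g ∘ ρ`, so that `j¹ₓs · g = j¹ₓ(s · g)`. -/
def act (j : JetFrame n M) (g : GLn n) : JetFrame n M where
  point := j.point.act g
  lift := (FrameBundle.dAct g j.point).comp j.lift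
  comp_lift := by
    ext v : 1
    exact (DFunLike.congr_fun (FrameBundle.dproj_comp_dAct g j.point) (j.lift v)).trans
      (DFunLike.congr_fun j.comp_lift v)

end JetFrame

/-- The form `θ = τ₁₀^* θ̄` on `J¹LM`. -/
def jetTautologicalForm (j : JetFrame n M) : TangentSpace (jetFrameModel n) j →L[ℝ] RVec n :=
  pullbackOneForm (jetFrameModel n) (frameModel n) JetFrame.toFrame
    FrameBundle.tautologicalForm j

namespace FrameBundle

theorem act_one (u : FrameBundle n M) : u.act 1 = u := rfl

theorem act_act (u : FrameBundle n M) (g h : GLn n) : (u.act g).act h = u.act (g * h) := rfl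

theorem dAct_one (u : FrameBundle n M) : dAct 1 u = ContinuousLinearMap.id ℝ _ :=
  mfderiv_id

theorem dAct_comp (u : FrameBundle n M) (g h : GLn n) :
    (dAct h (u.act g)).comp (dAct g u) = dAct (g * h) u :=
  (mfderiv_comp u ((contMDiff_act h).mdifferentiableAt (by simp))
    ((contMDiff_act g).mdifferentiableAt (by simp))).symm

/-- The action of `GL(n)` on `LM` is free. -/
theorem eq_one_of_act_eq {u : FrameBundle n M} {g : GLn n} (h : u.act g = u) : g = 1 := by
  obtain ⟨⟨x, f⟩, hf⟩ := u
  have h1 := congrArg Subtype.val h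
  have h2 : f.comp (g : RVec n →L[ℝ] RVec n) = f :=
    eq_of_heq (TotalSpace.mk.inj h1).2
  ext v : 2
  exact hf.injective (DFunLike.congr_fun h2 v)

/-- The action of `GL(n)` on the fibres of `LM` is transitive. -/
theorem exists_act_eq {u u' : FrameBundle n M} (h : u.proj = u'.proj) :
    ∃ g : GLn n, u.act g = u' := by
  obtain ⟨⟨x, f⟩, hf⟩ := u
  obtain ⟨⟨x', f'⟩, hf'⟩ := u'
  obtain rfl : x = x' := h
  obtain ⟨e, he⟩ := id hf
  obtain ⟨e', he'⟩ := id hf'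
  refine ⟨(ContinuousLinearEquiv.unitsEquiv ℝ (RVec n)).symm (e'.trans e.symm), ?_⟩
  refine Subtype.ext (congrArg (TotalSpace.mk x) ?_)
  ext v : 1
  have h1 : f (e.symm (e' v)) = e (e.symm (e' v)) := (DFunLike.congr_fun he _).symm
  have h2 : e' v = f' v := DFunLike.congr_fun he' v
  exact h1.trans ((e.apply_symm_apply (e' v)).trans h2)

/-- The frame at `x` given by the preferred chart of `M` at `x`. -/
def ofChart (x : M) : FrameBundle n M :=
  mk x (ContinuousLinearMap.id ℝ (RVec n)) ⟨.refl ℝ (RVec n), rfl⟩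

end FrameBundle

namespace JetFrame

theorem act_one (j : JetFrame n M) : j.act 1 = j :=
  Jet.ofModel_congr rfl (congrArg (fun L : RVec n × (RVec n →L[ℝ] RVec n) →L[ℝ] RVec n ×
    (RVec n →L[ℝ] RVec n) => L.comp (j.lift : RVec n →L[ℝ] RVec n × (RVec n →L[ℝ] RVec n)))
    (FrameBundle.dAct_one j.point))

theorem act_act (j : JetFrame n M) (g h : GLn n) : (j.act g).act h = j.act (g * h) :=
  Jet.ofModel_congr rfl (congrArg (fun L : RVec n × (RVec n →L[ℝ] RVec n) →L[ℝ] RVec n ×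
    (RVec n →L[ℝ] RVec n) => L.comp (j.lift : RVec n →L[ℝ] RVec n × (RVec n →L[ℝ] RVec n)))
    (FrameBundle.dAct_comp j.point g h))

variable (n M) in
/-- Two jets are equivalent if they are in the same orbit of `GL(n)`. -/
def orbitSetoid : Setoid (JetFrame n M) where
  r j j' := ∃ g : GLn n, j.act g = j'
  iseqv :=
    { refl := fun j => ⟨1, act_one j⟩
      symm := by
        rintro j _ ⟨g, rfl⟩
        exact ⟨g⁻¹, by rw [act_act, mul_inv_cancel, act_one]⟩
      trans := by
        rintro j _ _ ⟨g, rfl⟩ ⟨h, rfl⟩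
        exact ⟨g * h, (act_act j g h).symm⟩ }

end JetFrame

variable (n M) in
/-- The bundle of connections `C(LM) = J¹LM / GL(n)`. -/
def ConnectionBundle : Type _ := Quotient (JetFrame.orbitSetoid n M)

namespace ConnectionBundle

/-- The class `[ρ]` in `C(LM)` of a jet `ρ`. -/
def mk (j : JetFrame n M) : ConnectionBundle n M := Quotient.mk (JetFrame.orbitSetoid n M) j

/-- The projection `p : C(LM) → M`. -/
def base (c : ConnectionBundle n M) : M :=
  Quotient.lift (s := JetFrame.orbitSetoid n M) JetFrame.base
    (by rintro j _ ⟨g, rfl⟩; rfl) c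

end ConnectionBundle

variable (n M) in
/-- The pullback bundle `p^*LM` over `C(LM)`. -/
def PullbackFrame : Type _ :=
  {q : ConnectionBundle n M × FrameBundle n M // q.1.base = q.2.proj}

/-- The map `J¹LM → p^*LM`, `ρ ↦ ([ρ], τ₁₀ ρ)`. -/
def JetFrame.toPullback (j : JetFrame n M) : PullbackFrame n M :=
  ⟨(ConnectionBundle.mk j, j.toFrame), rfl⟩

theorem JetFrame.toPullback_bijective :
    Function.Bijective (JetFrame.toPullback : JetFrame n M → PullbackFrame n M) := by
  constructor
  · intro j j' h
    have h1 := congrArg Subtype.val h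
    obtain ⟨g, rfl⟩ : ∃ g : GLn n, j.act g = j' :=
      Quotient.exact (s := JetFrame.orbitSetoid n M) (congrArg Prod.fst h1)
    have hg : g = 1 := FrameBundle.eq_one_of_act_eq (congrArg Prod.snd h1).symm
    rw [hg, JetFrame.act_one]
  · rintro ⟨⟨c, u⟩, h⟩
    obtain ⟨j, rfl⟩ : ∃ j, ConnectionBundle.mk j = c :=
      Quotient.exists_rep (s := JetFrame.orbitSetoid n M) c
    obtain ⟨g, rfl⟩ := FrameBundle.exists_act_eq (u := j.point) (u' := u) h
    refine ⟨j.act g, Subtype.ext (Prod.ext ?_ rfl)⟩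
    exact Quotient.sound (s := JetFrame.orbitSetoid n M) ⟨g⁻¹, by
      rw [JetFrame.act_act, mul_inv_cancel, JetFrame.act_one]⟩

variable (n M) in
/-- The identification `J¹LM ≃ p^*LM`. -/
def jetEquivPullback : JetFrame n M ≃ PullbackFrame n M :=
  Equiv.ofBijective JetFrame.toPullback JetFrame.toPullback_bijective

variable (n M) in
/-- A (principal) connection `Γ` on `LM`: a smooth family of projections `Γ_u` of `T_u LM` onto the
vertical space `V_u LM = ker T_u τ` that is equivariant for the right action of `GL(n)`. -/
structure FrameConnection where
  vert : ∀ u : FrameBundle n M, TangentSpace (frameModel n) u →L[ℝ] TangentSpace (frameModel n) u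
  vert_mem : ∀ u X, mfderiv (frameModel n) (𝓡 n) FrameBundle.proj u (vert u X) = 0
  vert_eq_self : ∀ u X, mfderiv (frameModel n) (𝓡 n) FrameBundle.proj u X = 0 → vert u X = X
  equivariant : ∀ (u : FrameBundle n M) (g : GLn n),
    (vert (u.act g)).comp (FrameBundle.dAct g u) = (FrameBundle.dAct g u).comp (vert u)
  smooth : ContMDiff (frameModel n).tangent (frameModel n).tangent ∞
    (fun X : TangentBundle (frameModel n) (FrameBundle n M) =>
      (⟨X.1, vert X.1 X.2⟩ : TangentBundle (frameModel n) (FrameBundle n M)))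

namespace FrameConnection

variable (Γ : FrameConnection n M)

theorem exists_lift (u : FrameBundle n M) :
    ∃ ρ : TangentSpace (𝓡 n) u.proj →L[ℝ] TangentSpace (frameModel n) u,
      (mfderiv (frameModel n) (𝓡 n) FrameBundle.proj u).comp ρ = ContinuousLinearMap.id ℝ _ ∧
      ∀ X, Γ.vert u X = X - ρ (mfderiv (frameModel n) (𝓡 n) FrameBundle.proj u X) :=
  exists_lift_of_projection (B := RVec n) (X := RVec n × (RVec n →L[ℝ] RVec n))
    _ _ (ContinuousLinearMap.inl ℝ (RVec n) (RVec n →L[ℝ] RVec n)) (Γ.vert_mem u)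
    (Γ.vert_eq_self u) (fun _ => DFunLike.congr_fun
      (AdaptedCharts.mfderiv_eq_fst (IB := 𝓡 n) (IP := frameModel n) u) _)

/-- The jet `ρ : T_x M → T_u LM` at the frame `u` determined by `Γ`, for which
`Γ_u = id - ρ ∘ T_u τ`: the horizontal lift at `u`. -/
def horizontalJet (u : FrameBundle n M) : JetFrame n M where
  point := u
  lift := (Γ.exists_lift u).choose
  comp_lift := (Γ.exists_lift u).choose_spec.1

/-- The lift of the jet determined by `Γ` at `u`. -/
def horizontalLift (u : FrameBundle n M) :
    TangentSpace (𝓡 n) u.proj →L[ℝ] TangentSpace (frameModel n) u :=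
  (Γ.horizontalJet u).lift

theorem vert_eq (u : FrameBundle n M) (X : TangentSpace (frameModel n) u) :
    Γ.vert u X = X - Γ.horizontalLift u
      (mfderiv (frameModel n) (𝓡 n) FrameBundle.proj u X) :=
  (Γ.exists_lift u).choose_spec.2 X

theorem horizontalJet_act (u : FrameBundle n M) (g : GLn n) :
    (Γ.horizontalJet u).act g = Γ.horizontalJet (u.act g) :=
  Jet.ofModel_congr rfl <| lift_eq_of_equivariant (B := RVec n)
    (X := RVec n × (RVec n →L[ℝ] RVec n))
    (mfderiv (frameModel n) (𝓡 n) FrameBundle.proj u)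
    (mfderiv (frameModel n) (𝓡 n) FrameBundle.proj (u.act g)) (Γ.vert u) (Γ.vert (u.act g))
    (Γ.horizontalLift u) (Γ.horizontalLift (u.act g)) (FrameBundle.dAct g u)
    (Γ.horizontalJet u).comp_lift (Γ.vert_eq u) (Γ.vert_eq (u.act g))
    (FrameBundle.dproj_comp_dAct g u) (Γ.equivariant u g)

/-- The section `σ_Γ : M → C(LM)` determined by `Γ`: its value at `x` is the class of the jet
determined by `Γ` at any frame at `x`. -/
def toSection (x : M) : ConnectionBundle n M :=
  ConnectionBundle.mk (Γ.horizontalJet (FrameBundle.ofChart x))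

theorem base_toSection (x : M) : (Γ.toSection x).base = x := rfl

theorem mk_horizontalJet (u : FrameBundle n M) :
    ConnectionBundle.mk (Γ.horizontalJet u) = Γ.toSection u.proj := by
  obtain ⟨g, hg⟩ := FrameBundle.exists_act_eq (u := u) (u' := FrameBundle.ofChart u.proj) rfl
  refine Quotient.sound (s := JetFrame.orbitSetoid n M) ⟨g, ?_⟩
  rw [horizontalJet_act, hg]

/-- The map `σ̃_Γ : LM → J¹LM`, `u ↦ (σ_Γ (τ u), u)`, under the identification
`J¹LM ≃ p^*LM`. -/
def sigmaTilde (u : FrameBundle n M) : JetFrame n M :=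
  (jetEquivPullback n M).symm ⟨(Γ.toSection u.proj, u), Γ.base_toSection u.proj⟩

theorem sigmaTilde_eq (u : FrameBundle n M) : Γ.sigmaTilde u = Γ.horizontalJet u := by
  refine (Equiv.symm_apply_eq _).2 ?_
  exact Subtype.ext (Prod.ext (Γ.mk_horizontalJet u).symm rfl)

end FrameConnection

end JetFrameBundle

end

/-! ### Coordinate changes, families of linear maps, pullbacks of 1-forms -/

section Coordinates

variable {E H M : Type*} [NormedAddCommGroup E] [NormedSpace ℝ E] [TopologicalSpace H]
  {I : ModelWithCorners ℝ E H} [TopologicalSpace M] [ChartedSpace H M]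
  {E' H' M' : Type*} [NormedAddCommGroup E'] [NormedSpace ℝ E'] [TopologicalSpace H']
  {I' : ModelWithCorners ℝ E' H'} [TopologicalSpace M'] [ChartedSpace H' M']
  {EN HN N : Type*} [NormedAddCommGroup EN] [NormedSpace ℝ EN] [TopologicalSpace HN]
  {IN : ModelWithCorners ℝ EN HN} [TopologicalSpace N] [ChartedSpace HN N]

/-! The algebraic content is short, because `θ` comes from `θ̄` by pullback along the equivariant
map `τ₁₀`. Since `τ ∘ R_g = τ` and `(u ∘ g)⁻¹ = g⁻¹ ∘ u⁻¹`, the form `θ̄` satisfies `R_g^* θ̄ = g⁻¹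
· θ̄` (`tautologicalForm_dAct`), and `θ` inherits this. A vector tangent to an orbit is killed by
`T(τ ∘ τ₁₀)`, as `τ ∘ τ₁₀` is constant on orbits, so `θ` vanishes on it. Finally `τ₁₀ ∘ σ̃_Γ = id`,
whence `σ̃_Γ^* θ = (τ₁₀ ∘ σ̃_Γ)^* θ̄ = θ̄`. All three arguments are chain rules, and
`jetTautologicalForm_mfderiv` is their common form.

The work lies in smoothness, which the chain rule also needs: `mfderiv` is zero by convention where
a map is not differentiable. Everything is computed in the adapted charts. A frame `u` at `x` has
coordinates `(x, A)`, where `A` is `u` followed by the derivative of the chart of `M`. Then `R_g`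
becomes the linear map `(x, A) ↦ (x, A ∘ g)`, and `θ̄` becomes `A⁻¹` applied to the base component
of the tangent vector, which is smooth because inversion is smooth at invertible operators. On jets,
`g` acts on the additional coordinate by postcomposition with `A ↦ A ∘ g`.

For a connection, `σ̃_Γ(u)` is the horizontal lift `ρ` at `u`. From `Γ_u = id - ρ ∘ T_u τ`, the
value of `ρ` at a vector is `X - Γ_u X` for any `X` above it. Taking `X` with coordinates `(v, 0)`
expresses the jet coordinate through `Γ` alone (`jetCoord_horizontalLift`), so smoothness of `Γ`
gives that of `σ̃_Γ`. -/

theorem isInvertible_tangentCoordChange [I.Boundaryless] [IsManifold I ∞ M] {a b x : M}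
    (ha : x ∈ (extChartAt I a).source)
    (hb : x ∈ (extChartAt I b).source) : (tangentCoordChange I a b x).IsInvertible :=
  .of_inverse (g := tangentCoordChange I b a x)
    (ContinuousLinearMap.ext fun v => tangentCoordChange_symm hb ha v)
    (ContinuousLinearMap.ext fun v => tangentCoordChange_symm ha hb v)

/-- The derivative of an extended chart is the tangent coordinate change. -/
theorem hasMFDerivAt_extChartAt_tangentCoordChange [IsManifold I ∞ M] {a x : M}
    (hx : x ∈ (extChartAt I a).source) :
    HasMFDerivAt I 𝓘(ℝ, E) (extChartAt I a) x (tangentCoordChange I x a x : E →L[ℝ] E) := by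
  refine ⟨continuousAt_extChartAt' hx, ?_⟩
  exact hasFDerivWithinAt_tangentCoordChange (I := I) (x := x) (y := a)
    ⟨mem_extChartAt_source x, hx⟩

/-- A family of continuous linear maps on a finite-dimensional space is smooth if all of its
evaluations are. -/
theorem contMDiffAt_clm_of_apply [FiniteDimensional ℝ E] {f : N → E →L[ℝ] E'} {x : N}
    (h : ∀ v, ContMDiffAt IN 𝓘(ℝ, E') ∞ (fun y => f y v) x) :
    ContMDiffAt IN 𝓘(ℝ, E →L[ℝ] E') ∞ f x := by
  let b := Module.finBasis ℝ E
  -- Expansion in a basis: `f y = ∑ bᵢ* ⊗ f y (bᵢ)`. Each summand is a fixed continuous linear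
  -- function of the vector `f y (bᵢ)`.
  have e : f = fun y => ∑ i, (ContinuousLinearMap.smulRightL ℝ E E'
      (LinearMap.toContinuousLinearMap (b.coord i))) (f y (b i)) := by
    ext y v
    conv_lhs => rw [← b.sum_repr v]
    simp only [map_sum, map_smul]
    simp
  rw [e]
  refine ContMDiffAt.sum fun i _ => ?_
  exact (ContinuousLinearMap.contMDiff _).contMDiffAt.comp x (h (b i))

/-- Precomposition with `g` depends linearly and continuously on `g`. This is the coordinate form of
the action on jets. -/
theorem contMDiffAt_precompose_comp {g : N → E →L[ℝ] E} {A : N → E' →L[ℝ] (E →L[ℝ] E)} {x : N}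
    (hg : ContMDiffAt IN 𝓘(ℝ, E →L[ℝ] E) ∞ g x)
    (hA : ContMDiffAt IN 𝓘(ℝ, E' →L[ℝ] (E →L[ℝ] E)) ∞ A x) :
    ContMDiffAt IN 𝓘(ℝ, E' →L[ℝ] (E →L[ℝ] E)) ∞
      (fun y => ((ContinuousLinearMap.compL ℝ E E E).flip (g y)).comp (A y)) x :=
  ((ContinuousLinearMap.contMDiff (ContinuousLinearMap.compL ℝ E E E).flip).contMDiffAt.comp x
    hg).clm_comp hA

/-- The pullback of a smooth 1-form along a smooth map is smooth. -/
theorem contMDiff_pullbackOneForm {f : M → M'} (hf : ContMDiff I I' ∞ f) [IsManifold I 1 M]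
    [IsManifold I' 1 M'] {α : ∀ q : M', TangentSpace I' q →L[ℝ] EN}
    (hα : ContMDiff I'.tangent 𝓘(ℝ, EN) ∞ (fun Z : TangentBundle I' M' => α Z.1 Z.2)) :
    ContMDiff I.tangent 𝓘(ℝ, EN) ∞
      (fun Z : TangentBundle I M => pullbackOneForm I I' f α Z.1 Z.2) :=
  -- As a function on the tangent bundle, `f^*α` is `α` composed with the tangent map of `f`.
  hα.comp (hf.contMDiff_tangentMap (m := ∞) (by simp))

/-- Serves to recover a horizontal lift from the vertical projection `A`. It is stated for normed
spaces, to which the tangent spaces in question reduce by definition. -/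
theorem apply_eq_sub_of_eq_sub_apply {B X : Type*} [NormedAddCommGroup B] [NormedSpace ℝ B]
    [NormedAddCommGroup X] [NormedSpace ℝ X] (A : X →L[ℝ] X) (ρ : B →L[ℝ] X) {Y : X} {v w : B}
    (h : A Y = Y - ρ v) (hv : v = w) : ρ w = Y - A Y := by
  rw [h, hv, sub_sub_cancel]

end Coordinates

/-! ### Smooth maps into and out of the jet bundle -/

section JetSmoothness

variable {EB F HB HP M P : Type*}
  [NormedAddCommGroup EB] [NormedSpace ℝ EB] [NormedAddCommGroup F] [NormedSpace ℝ F]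
  [TopologicalSpace HB] [TopologicalSpace HP]
  [TopologicalSpace M] [ChartedSpace HB M] [TopologicalSpace P] [ChartedSpace HP P]
  {IB : ModelWithCorners ℝ EB HB} {IP : ModelWithCorners ℝ (EB × F) HP}
  {τ : P → M} [hτ : AdaptedCharts IB IP τ]
  [IsManifold IB ∞ M] [IsManifold IP ∞ P] [IB.Boundaryless] [IP.Boundaryless]
  {EN HN N : Type*} [NormedAddCommGroup EN] [NormedSpace ℝ EN] [TopologicalSpace HN]
  {IN : ModelWithCorners ℝ EN HN} [TopologicalSpace N] [ChartedSpace HN N]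

namespace Jet

theorem extChartAt_apply (j₀ j : Jet IB IP τ) :
    extChartAt 𝓘(ℝ, (EB × F) × (EB →L[ℝ] F)) j₀ j =
      (extChartAt IP j₀.point j.point, jetCoord IB IP τ j₀.point j.point j.lift) := rfl

theorem extChartAt_source (j₀ : Jet IB IP τ) :
    (extChartAt 𝓘(ℝ, (EB × F) × (EB →L[ℝ] F)) j₀).source =
      Jet.point ⁻¹' (extChartAt IP j₀.point).source := by
  rw [_root_.extChartAt_source]
  rfl

/-- The projection `J¹P → P` is smooth. -/
theorem contMDiff_point :
    ContMDiff 𝓘(ℝ, (EB × F) × (EB →L[ℝ] F)) IP ∞ (Jet.point : Jet IB IP τ → P) := by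
  intro j₀
  have h1 : ContMDiffAt 𝓘(ℝ, (EB × F) × (EB →L[ℝ] F)) 𝓘(ℝ, EB × F) ∞
      (fun j : Jet IB IP τ => extChartAt IP j₀.point j.point) j₀ :=
    (contDiff_fst (𝕜 := ℝ) (E := EB × F) (F := EB →L[ℝ] F)).contMDiff.contMDiffAt.comp j₀
      (contMDiffAt_extChartAt (I := 𝓘(ℝ, (EB × F) × (EB →L[ℝ] F))) (x := j₀))
  have h2 := (contMDiffOn_extChartAt_symm (I := IP) (n := ∞) j₀.point).contMDiffAt
    (extChartAt_target_mem_nhds (I := IP) j₀.point)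
  refine (h2.comp j₀ h1).congr_of_eventuallyEq ?_
  filter_upwards [extChartAt_source_mem_nhds (I := 𝓘(ℝ, (EB × F) × (EB →L[ℝ] F))) j₀] with j hj
  exact ((extChartAt IP j₀.point).left_inv ((extChartAt_source j₀).subset hj)).symm

/-- A map into `J¹P` is smooth if its base point and its coordinate in the adapted charts are. -/
theorem contMDiffAt_of_point_of_jetCoord {f : N → Jet IB IP τ} {x : N}
    (h1 : ContMDiffAt IN IP ∞ (fun y => (f y).point) x)
    (h2 : ContMDiffAt IN 𝓘(ℝ, EB →L[ℝ] F) ∞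
      (fun y => jetCoord IB IP τ (f x).point (f y).point (f y).lift) x) :
    ContMDiffAt IN 𝓘(ℝ, (EB × F) × (EB →L[ℝ] F)) ∞ f x := by
  have h3 : ContMDiffAt IN 𝓘(ℝ, EB × F) ∞
      (fun y => extChartAt IP (f x).point (f y).point) x :=
    (contMDiffAt_extChartAt (I := IP) (x := (f x).point)).comp x h1
  have h4 := (contMDiffOn_extChartAt_symm (I := 𝓘(ℝ, (EB × F) × (EB →L[ℝ] F))) (n := ∞)
    (f x)).contMDiffAt (extChartAt_target_mem_nhds (f x))
  refine (h4.comp x (h3.prodMk_space h2)).congr_of_eventuallyEq ?_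
  filter_upwards [h1.continuousAt.preimage_mem_nhds
    (extChartAt_source_mem_nhds (I := IP) (f x).point)] with y hy
  exact ((extChartAt 𝓘(ℝ, (EB × F) × (EB →L[ℝ] F)) (f x)).left_inv
    ((extChartAt_source (f x)).symm.subset hy)).symm

/-- The coordinate of a moving jet in the adapted charts at a jet is smooth. -/
theorem contMDiffAt_jetCoord (j₀ : Jet IB IP τ) :
    ContMDiffAt 𝓘(ℝ, (EB × F) × (EB →L[ℝ] F)) 𝓘(ℝ, EB →L[ℝ] F) ∞
      (fun j : Jet IB IP τ => jetCoord IB IP τ j₀.point j.point j.lift) j₀ :=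
  (contDiff_snd (𝕜 := ℝ) (E := EB × F) (F := EB →L[ℝ] F)).contMDiff.contMDiffAt.comp j₀
    (contMDiffAt_extChartAt (I := 𝓘(ℝ, (EB × F) × (EB →L[ℝ] F))) (x := j₀))

end Jet

end JetSmoothness

/-! ### The frame bundle in charts: right action and tautological form -/

section FrameCoordinates

variable {n : ℕ} {M : Type*} [TopologicalSpace M] [ChartedSpace (RVec n) M]
  [IsManifold (𝓡 n) ∞ M]

/-- Precomposition with `g` on the endomorphisms of `ℝⁿ`. -/
noncomputable abbrev precompose (g : RVec n →L[ℝ] RVec n) :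
    (RVec n →L[ℝ] RVec n) →L[ℝ] (RVec n →L[ℝ] RVec n) :=
  (ContinuousLinearMap.compL ℝ (RVec n) (RVec n) (RVec n)).flip g

theorem inverse_comp_apply_self {A f : RVec n →L[ℝ] RVec n} (hA : A.IsInvertible) (v : RVec n) :
    (A.comp f).inverse (A v) = f.inverse v := by
  rw [hA.inverse_comp_apply_of_left, hA.inverse_apply_self]

theorem inverse_comp_units_apply {f : RVec n →L[ℝ] RVec n} (hf : f.IsInvertible) (g : GLn n)
    (v : RVec n) : (f.comp (g : RVec n →L[ℝ] RVec n)).inverse v =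
      ((g⁻¹ : GLn n) : RVec n →L[ℝ] RVec n) (f.inverse v) := by
  rw [hf.inverse_comp_apply_of_left, ← ContinuousLinearMap.ringInverse_eq_inverse,
    Ring.inverse_unit]

namespace FrameBundle

theorem mem_source {u₀ u : FrameBundle n M} : u ∈ (extChartAt (frameModel n) u₀).source ↔
    u.proj ∈ (extChartAt (𝓡 n) u₀.proj).source :=
  AdaptedCharts.mem_source (IB := 𝓡 n) (IP := frameModel n)

/-- The chart comes from the trivialization of `Hom(ℝⁿ, TM)`. The factor `ℝⁿ` is a trivial bundle
and contributes the identity, so only the coordinate change of `TM` remains. -/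
theorem extChartAt_apply {u₀ u : FrameBundle n M}
    (hu : u ∈ (extChartAt (frameModel n) u₀).source) :
    extChartAt (frameModel n) u₀ u = (extChartAt (𝓡 n) u₀.proj u.proj,
      (tangentCoordChange (𝓡 n) u.proj u₀.proj u.proj).comp
        (u.toHom : RVec n →L[ℝ] RVec n)) := by
  have hu' := mem_source.1 hu
  rw [extChartAt_source] at hu'
  refine Prod.ext rfl ?_
  change ContinuousLinearMap.inCoordinates (RVec n) (Bundle.Trivial M (RVec n)) (RVec n)
    (TangentSpace (𝓡 n)) u₀.proj u.proj u₀.proj u.proj u.toHom = _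
  have e (x₀ x : M) : (trivializationAt (RVec n) (Bundle.Trivial M (RVec n)) x₀).symmL ℝ x =
      ContinuousLinearMap.id ℝ (RVec n) := Bundle.Trivial.symmL_trivialization ℝ M (RVec n) x
  simp only [ContinuousLinearMap.inCoordinates]
  rw [e, TangentBundle.continuousLinearMapAt_trivializationAt_eq_core hu']
  rfl

theorem act_mem_source {u₀ u : FrameBundle n M}
    (hu : u ∈ (extChartAt (frameModel n) u₀).source) (g : GLn n) :
    u.act g ∈ (extChartAt (frameModel n) u₀).source :=
  mem_source.2 (mem_source.1 hu)

theorem extChartAt_act {u₀ u : FrameBundle n M}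
    (hu : u ∈ (extChartAt (frameModel n) u₀).source) (g : GLn n) :
    extChartAt (frameModel n) u₀ (u.act g) =
      (ContinuousLinearMap.id ℝ (RVec n)).prodMap (precompose (g : RVec n →L[ℝ] RVec n))
        (extChartAt (frameModel n) u₀ u) := by
  rw [extChartAt_apply hu, extChartAt_apply (act_mem_source hu g)]
  rfl

/-- In the charts of `LM`, the derivative of a right translation is a precomposition. -/
theorem tangentCoordChange_dAct {u₀ u : FrameBundle n M}
    (hu : u ∈ (extChartAt (frameModel n) u₀).source) (g : GLn n)
    (X : RVec n × (RVec n →L[ℝ] RVec n)) :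
    tangentCoordChange (frameModel n) (u.act g) u₀ (u.act g) (dAct g u X) =
      (ContinuousLinearMap.id ℝ (RVec n)).prodMap (precompose (g : RVec n →L[ℝ] RVec n))
        (tangentCoordChange (frameModel n) u u₀ u X) := by
  -- Both sides are derivatives at `u` of one map, the chart after `R_g`; by `extChartAt_act` it is
  -- also the linear map after the chart.
  have h1 := (hasMFDerivAt_extChartAt_tangentCoordChange (act_mem_source hu g)).comp u
    ((contMDiff_act g).mdifferentiableAt (by simp)).hasMFDerivAt
  have h2 := (ContinuousLinearMap.hasMFDerivAt ((ContinuousLinearMap.id ℝ (RVec n)).prodMap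
    (precompose (g : RVec n →L[ℝ] RVec n)))).comp u
      (hasMFDerivAt_extChartAt_tangentCoordChange hu)
  have h3 : extChartAt (frameModel n) u₀ ∘ (fun v : FrameBundle n M => v.act g) =ᶠ[𝓝 u]
      (ContinuousLinearMap.id ℝ (RVec n)).prodMap (precompose (g : RVec n →L[ℝ] RVec n)) ∘
        extChartAt (frameModel n) u₀ := by
    filter_upwards [extChartAt_source_mem_nhds' hu] with v hv
    exact extChartAt_act hv g
  exact DFunLike.congr_fun (hasMFDerivAt_unique h1 (h2.congr_of_eventuallyEq h3)) X

/-- The action of `GL(n)` on `LM` is smooth. -/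
theorem contMDiff_act_prod :
    ContMDiff ((frameModel n).prod 𝓘(ℝ, RVec n →L[ℝ] RVec n)) (frameModel n) ∞
      (fun p : FrameBundle n M × GLn n => p.1.act p.2) := by
  rintro ⟨u₀, g₀⟩
  have h1 : ContMDiffAt ((frameModel n).prod 𝓘(ℝ, RVec n →L[ℝ] RVec n))
      𝓘(ℝ, RVec n × (RVec n →L[ℝ] RVec n)) ∞
      (fun p : FrameBundle n M × GLn n => extChartAt (frameModel n) u₀ p.1) (u₀, g₀) :=
    (contMDiffAt_extChartAt (I := frameModel n) (x := u₀)).comp (u₀, g₀) contMDiffAt_fst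
  have h2 : ContMDiffAt ((frameModel n).prod 𝓘(ℝ, RVec n →L[ℝ] RVec n))
      𝓘(ℝ, RVec n →L[ℝ] RVec n) ∞
      (fun p : FrameBundle n M × GLn n => (p.2 : RVec n →L[ℝ] RVec n)) (u₀, g₀) :=
    (Units.contMDiff_val (𝕜 := ℝ) _).comp (u₀, g₀) contMDiffAt_snd
  have h3 := (contDiff_fst (𝕜 := ℝ) (E := RVec n)
    (F := RVec n →L[ℝ] RVec n)).contMDiff.contMDiffAt.comp _ h1
  have h4 := (contDiff_snd (𝕜 := ℝ) (E := RVec n)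
    (F := RVec n →L[ℝ] RVec n)).contMDiff.contMDiffAt.comp _ h1
  have h5 := (contMDiffOn_extChartAt_symm (I := frameModel n) (n := ∞)
    (u₀.act g₀)).contMDiffAt (extChartAt_target_mem_nhds (I := frameModel n) (u₀.act g₀))
  -- The chart of `LM` at a frame depends only on its base point, so the charts at `u₀` and `u₀ ·
  -- g₀` agree by definition.
  have h6 : extChartAt (frameModel n) (u₀.act g₀) (u₀.act g₀) =
      (fun p : FrameBundle n M × GLn n => ((extChartAt (frameModel n) u₀ p.1).1,
        (extChartAt (frameModel n) u₀ p.1).2.comp (p.2 : RVec n →L[ℝ] RVec n))) (u₀, g₀) :=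
    extChartAt_act (mem_extChartAt_source u₀) g₀
  rw [h6] at h5
  refine (h5.comp (u₀, g₀) (h3.prodMk_space (h4.clm_comp h2))).congr_of_eventuallyEq ?_
  filter_upwards [continuousAt_fst.preimage_mem_nhds
    (extChartAt_source_mem_nhds (I := frameModel n) u₀)] with p hp
  have h7 := (extChartAt (frameModel n) u₀).left_inv (act_mem_source hp p.2)
  rw [extChartAt_act hp] at h7
  exact h7.symm

/-- The same coordinate change multiplies the frame and the base vector, and cancels. What is left
involves only operators on the fixed space `ℝⁿ`, where smoothness can be tested. -/
theorem tautologicalForm_eq_inverse_extChartAt {u₀ u : FrameBundle n M}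
    (hu : u ∈ (extChartAt (frameModel n) u₀).source) (X : TangentSpace (frameModel n) u) :
    tautologicalForm u X = (extChartAt (frameModel n) u₀ u).2.inverse
      (tangentCoordChange (𝓡 n) u.proj u₀.proj u.proj
        (mfderiv (frameModel n) (𝓡 n) proj u X : RVec n)) := by
  have hi : (tangentCoordChange (𝓡 n) u.proj u₀.proj u.proj).IsInvertible :=
    isInvertible_tangentCoordChange (mem_extChartAt_source _) (mem_source.1 hu)
  rw [extChartAt_apply hu]
  exact (inverse_comp_apply_self (f := u.toHom) hi _).symm

/-- The tautological form of `LM` is smooth. -/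
theorem contMDiff_tautologicalForm :
    ContMDiff (frameModel n).tangent 𝓘(ℝ, RVec n) ∞
      (fun Z : TangentBundle (frameModel n) (FrameBundle n M) => tautologicalForm Z.1 Z.2) := by
  intro Z₀
  set u₀ := Z₀.1
  have hproj : ContMDiffAt (frameModel n).tangent (frameModel n) ∞
      (fun Z : TangentBundle (frameModel n) (FrameBundle n M) => Z.1) Z₀ :=
    Bundle.contMDiff_proj (TangentSpace (frameModel n)) Z₀
  have h1 : ContMDiffAt (frameModel n).tangent 𝓘(ℝ, RVec n →L[ℝ] RVec n) ∞
      (fun Z : TangentBundle (frameModel n) (FrameBundle n M) =>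
        (extChartAt (frameModel n) u₀ Z.1).2) Z₀ :=
    (contDiff_snd (𝕜 := ℝ) (E := RVec n)
      (F := RVec n →L[ℝ] RVec n)).contMDiff.contMDiffAt.comp Z₀
      ((contMDiffAt_extChartAt (I := frameModel n) (x := u₀)).comp Z₀ hproj)
  have hinv : (extChartAt (frameModel n) u₀ u₀).2.IsInvertible := by
    rw [extChartAt_apply (mem_extChartAt_source u₀)]
    exact (isInvertible_tangentCoordChange (mem_extChartAt_source _)
      (mem_extChartAt_source _)).comp u₀.isInvertible_toHom
  obtain ⟨e, he⟩ := hinv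
  have h2 : ContMDiffAt 𝓘(ℝ, RVec n →L[ℝ] RVec n) 𝓘(ℝ, RVec n →L[ℝ] RVec n) ∞
      (ContinuousLinearMap.inverse : (RVec n →L[ℝ] RVec n) → _)
      (extChartAt (frameModel n) u₀ u₀).2 := by
    rw [← he]
    exact (contDiffAt_map_inverse e).contMDiffAt
  -- The fibre coordinate of `T τ (Z)` in the trivialization at `τ u₀`: the vector to which the
  -- inverse frame is applied.
  have h3 := (contMDiffAt_totalSpace.1
    ((contMDiff_proj (n := n) (M := M)).contMDiff_tangentMap (m := ∞) (by simp) Z₀)).2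
  refine ((h2.comp Z₀ h1).clm_apply h3).congr_of_eventuallyEq ?_
  filter_upwards [hproj.continuousAt.preimage_mem_nhds
    (extChartAt_source_mem_nhds (I := frameModel n) u₀)] with Z hZ
  exact tautologicalForm_eq_inverse_extChartAt hZ Z.2

theorem tautologicalForm_dAct (u : FrameBundle n M) (g : GLn n)
    (X : TangentSpace (frameModel n) u) :
    tautologicalForm (u.act g) (dAct g u X) =
      ((g⁻¹ : GLn n) : RVec n →L[ℝ] RVec n) (tautologicalForm u X) := by
  have h1 : mfderiv (frameModel n) (𝓡 n) proj (u.act g) (dAct g u X) =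
      mfderiv (frameModel n) (𝓡 n) proj u X := DFunLike.congr_fun (dproj_comp_dAct g u) X
  exact (inverse_comp_units_apply (f := u.toHom) u.isInvertible_toHom g
    (mfderiv (frameModel n) (𝓡 n) proj (u.act g) (dAct g u X) : RVec n)).trans
    (congrArg (fun v : RVec n => ((g⁻¹ : GLn n) : RVec n →L[ℝ] RVec n)
      ((u.toHom : RVec n →L[ℝ] RVec n).inverse v)) h1)

end FrameBundle
end FrameCoordinates

/-! ### The action on the jet bundle and the form `θ` -/

section JetFrameSmoothness

variable {n : ℕ} {M : Type*} [TopologicalSpace M] [ChartedSpace (RVec n) M]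
  [IsManifold (𝓡 n) ∞ M]

namespace JetFrame

theorem contMDiff_toFrame : ContMDiff (jetFrameModel n) (frameModel n) ∞
    (toFrame : JetFrame n M → FrameBundle n M) :=
  Jet.contMDiff_point (IB := 𝓡 n) (IP := frameModel n)

/-- In the adapted charts, the action of `GL(n)` on jets is a postcomposition. -/
theorem jetCoord_act {u₀ : FrameBundle n M} {j : JetFrame n M}
    (hj : j.point ∈ (extChartAt (frameModel n) u₀).source) (g : GLn n) :
    jetCoord (𝓡 n) (frameModel n) FrameBundle.proj u₀ (j.act g).point (j.act g).lift =
      (precompose (g : RVec n →L[ℝ] RVec n)).comp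
        (jetCoord (𝓡 n) (frameModel n) FrameBundle.proj u₀ j.point j.lift) := by
  ext v : 1
  exact congrArg Prod.snd (FrameBundle.tangentCoordChange_dAct hj g (j.lift
    (tangentCoordChange (𝓡 n) u₀.proj j.point.proj j.point.proj v)))

/-- The action of `GL(n)` on `J¹LM` is smooth. -/
theorem contMDiff_act_prod :
    ContMDiff ((jetFrameModel n).prod 𝓘(ℝ, RVec n →L[ℝ] RVec n)) (jetFrameModel n) ∞
      (fun p : JetFrame n M × GLn n => p.1.act p.2) := by
  rintro ⟨j₀, g₀⟩
  have hp : ContMDiffAt ((jetFrameModel n).prod 𝓘(ℝ, RVec n →L[ℝ] RVec n)) (frameModel n) ∞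
      (fun p : JetFrame n M × GLn n => p.1.toFrame) (j₀, g₀) :=
    (contMDiff_toFrame j₀).comp (j₀, g₀) contMDiffAt_fst
  refine Jet.contMDiffAt_of_point_of_jetCoord ?_ ?_
  · exact ContMDiffAt.comp (g := fun p : FrameBundle n M × GLn n => p.1.act p.2) (j₀, g₀)
      (FrameBundle.contMDiff_act_prod (j₀.toFrame, g₀)) (hp.prodMk contMDiffAt_snd)
  · have h1 : ContMDiffAt ((jetFrameModel n).prod 𝓘(ℝ, RVec n →L[ℝ] RVec n))
        𝓘(ℝ, RVec n →L[ℝ] (RVec n →L[ℝ] RVec n)) ∞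
        (fun p : JetFrame n M × GLn n => jetCoord (𝓡 n) (frameModel n) FrameBundle.proj
          j₀.point p.1.point p.1.lift) (j₀, g₀) :=
      ContMDiffAt.comp (g := fun j : JetFrame n M => jetCoord (𝓡 n) (frameModel n)
        FrameBundle.proj j₀.point j.point j.lift) (j₀, g₀) (Jet.contMDiffAt_jetCoord j₀)
        contMDiffAt_fst
    have h2 : ContMDiffAt ((jetFrameModel n).prod 𝓘(ℝ, RVec n →L[ℝ] RVec n))
        𝓘(ℝ, RVec n →L[ℝ] RVec n) ∞
        (fun p : JetFrame n M × GLn n => (p.2 : RVec n →L[ℝ] RVec n)) (j₀, g₀) :=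
      (Units.contMDiff_val (𝕜 := ℝ) _).comp (j₀, g₀) contMDiffAt_snd
    refine (contMDiffAt_precompose_comp h2 h1).congr_of_eventuallyEq ?_
    filter_upwards [hp.continuousAt.preimage_mem_nhds
      (extChartAt_source_mem_nhds (I := frameModel n) j₀.point)] with p hp'
    exact jetCoord_act hp' p.2

theorem contMDiff_act (g : GLn n) : ContMDiff (jetFrameModel n) (jetFrameModel n) ∞
    (fun j : JetFrame n M => j.act g) :=
  contMDiff_act_prod.comp (contMDiff_id.prodMk contMDiff_const)

theorem contMDiff_orbitMap (j : JetFrame n M) :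
    ContMDiff 𝓘(ℝ, RVec n →L[ℝ] RVec n) (jetFrameModel n) ∞ (fun g : GLn n => j.act g) :=
  contMDiff_act_prod.comp (contMDiff_const.prodMk contMDiff_id)

theorem mdifferentiableAt_toFrame (j : JetFrame n M) :
    MDifferentiableAt (jetFrameModel n) (frameModel n) (toFrame : JetFrame n M → FrameBundle n M) j :=
  contMDiff_toFrame.mdifferentiableAt (by simp)

/-- The chain rule for the pullback of `θ = τ₁₀^* θ̄`. -/
theorem jetTautologicalForm_mfderiv {E H N : Type*} [NormedAddCommGroup E] [NormedSpace ℝ E]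
    [TopologicalSpace H] {I : ModelWithCorners ℝ E H} [TopologicalSpace N] [ChartedSpace H N]
    {f : N → JetFrame n M} {x : N} (hf : MDifferentiableAt I (jetFrameModel n) f x)
    (X : TangentSpace I x) :
    jetTautologicalForm (f x) (mfderiv I (jetFrameModel n) f x X) =
      FrameBundle.tautologicalForm (f x).toFrame
        (mfderiv I (frameModel n) (fun y => (f y).toFrame) x X) := by
  have h := mfderiv_comp x (mdifferentiableAt_toFrame (f x)) hf
  exact congrArg (FrameBundle.tautologicalForm (f x).toFrame) (DFunLike.congr_fun h X).symm

theorem pullback_act_jetTautologicalForm (g : GLn n) (j : JetFrame n M) :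
    pullbackOneForm (jetFrameModel n) (jetFrameModel n) (fun j' : JetFrame n M => j'.act g)
      jetTautologicalForm j =
      ((g⁻¹ : GLn n) : RVec n →L[ℝ] RVec n).comp (jetTautologicalForm j) := by
  ext X : 1
  refine (jetTautologicalForm_mfderiv ((contMDiff_act g).mdifferentiableAt (by simp)) X).trans ?_
  -- The map `τ₁₀ ∘ R_g` is by definition `R_g ∘ τ₁₀`; differentiating the latter leads to
  -- `tautologicalForm_dAct`.
  have h := mfderiv_comp j ((FrameBundle.contMDiff_act g).mdifferentiableAt (by simp))
    (mdifferentiableAt_toFrame j)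
  refine (congrArg (FrameBundle.tautologicalForm (j.toFrame.act g))
    (DFunLike.congr_fun h X)).trans ?_
  exact FrameBundle.tautologicalForm_dAct j.toFrame g _

theorem jetTautologicalForm_orbitMap (j : JetFrame n M) (g : GLn n)
    (ξ : TangentSpace 𝓘(ℝ, RVec n →L[ℝ] RVec n) g) :
    jetTautologicalForm (j.act g)
      (mfderiv 𝓘(ℝ, RVec n →L[ℝ] RVec n) (jetFrameModel n) (fun h : GLn n => j.act h) g ξ) =
      0 := by
  have hd : MDifferentiableAt 𝓘(ℝ, RVec n →L[ℝ] RVec n) (jetFrameModel n)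
      (fun h : GLn n => j.act h) g := (contMDiff_orbitMap j).mdifferentiableAt (by simp)
  refine (jetTautologicalForm_mfderiv hd ξ).trans ?_
  have hd' : MDifferentiableAt 𝓘(ℝ, RVec n →L[ℝ] RVec n) (frameModel n)
      (fun h : GLn n => (j.act h).toFrame) g := (mdifferentiableAt_toFrame _).comp g hd
  have h1 := mfderiv_comp g
    (FrameBundle.contMDiff_proj.mdifferentiableAt (x := (j.act g).toFrame) (by simp)) hd'
  -- By definition `τ (τ₁₀ (j · h))` is the base point of `j` for every `h`, so the composite in
  -- `h1` is this constant map.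
  have h2 : mfderiv 𝓘(ℝ, RVec n →L[ℝ] RVec n) (𝓡 n) (fun _ : GLn n => j.base) g = 0 :=
    mfderiv_const
  have h3 := (DFunLike.congr_fun h1 ξ).symm.trans (DFunLike.congr_fun h2 ξ)
  exact (congrArg (j.act g).toFrame.toHom.inverse h3).trans (map_zero _)

end JetFrame

/-! ### Smoothness of the section of a connection and pullback of `θ` -/

namespace FrameConnection

variable (Γ : FrameConnection n M)

/-- The horizontal lift of a connection in coordinates, in terms of its vertical projection. -/
theorem jetCoord_horizontalLift {u₀ u : FrameBundle n M}
    (hu : u ∈ (extChartAt (frameModel n) u₀).source) (v : RVec n) :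
    jetCoord (𝓡 n) (frameModel n) FrameBundle.proj u₀ u (Γ.horizontalLift u) v =
      -(tangentCoordChange (frameModel n) u u₀ u (Γ.vert u
        (tangentCoordChange (frameModel n) u₀ u u (v, 0)))).2 := by
  -- Any vector over `v` would do; zero fibre coordinate makes the term `X` drop out of the second
  -- component of `X - Γ_u X`.
  set X : RVec n × (RVec n →L[ℝ] RVec n) := tangentCoordChange (frameModel n) u₀ u u (v, 0)
  have h1 : (mfderiv (frameModel n) (𝓡 n) FrameBundle.proj u X : RVec n) =
      tangentCoordChange (𝓡 n) u₀.proj u.proj u.proj v := by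
    rw [AdaptedCharts.mfderiv_eq_fst (IB := 𝓡 n) (IP := frameModel n) u]
    exact AdaptedCharts.fst_tangentCoordChange (IB := 𝓡 n) (τ := FrameBundle.proj) hu
      (mem_extChartAt_source u) (v, 0)
  have h2 : (Γ.horizontalLift u (tangentCoordChange (𝓡 n) u₀.proj u.proj u.proj v) :
      RVec n × (RVec n →L[ℝ] RVec n)) = HSub.hSub (α := RVec n × (RVec n →L[ℝ] RVec n))
        (β := RVec n × (RVec n →L[ℝ] RVec n)) X (Γ.vert u X) :=
    apply_eq_sub_of_eq_sub_apply (B := RVec n) (X := RVec n × (RVec n →L[ℝ] RVec n))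
      (Γ.vert u) (Γ.horizontalLift u) (Γ.vert_eq u X) h1
  have h5 : tangentCoordChange (frameModel n) u u₀ u X = (v, 0) :=
    tangentCoordChange_symm hu (mem_extChartAt_source u) (v, 0)
  have h6 : tangentCoordChange (frameModel n) u u₀ u (Γ.horizontalLift u
      (tangentCoordChange (𝓡 n) u₀.proj u.proj u.proj v)) =
      (v, 0) - tangentCoordChange (frameModel n) u u₀ u (Γ.vert u X) :=
    (congrArg (tangentCoordChange (frameModel n) u u₀ u) h2).trans
      ((map_sub (tangentCoordChange (frameModel n) u u₀ u) X (Γ.vert u X)).trans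
        (congrArg (· - tangentCoordChange (frameModel n) u u₀ u (Γ.vert u X)) h5))
  exact (congrArg Prod.snd h6).trans (zero_sub _)

theorem contMDiff_horizontalJet :
    ContMDiff (frameModel n) (jetFrameModel n) ∞ Γ.horizontalJet := by
  intro u₀
  refine Jet.contMDiffAt_of_point_of_jetCoord contMDiffAt_id (contMDiffAt_clm_of_apply fun v => ?_)
  -- The local vector field with constant coordinates `(v, 0)`, to which `Γ` is then applied.
  have h1 : ContMDiffAt (frameModel n) (frameModel n).tangent ∞
      (fun u : FrameBundle n M => (⟨u, tangentCoordChange (frameModel n) u₀ u u (v, 0)⟩ :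
        TangentBundle (frameModel n) (FrameBundle n M))) u₀ := by
    refine contMDiffAt_totalSpace.2 ⟨contMDiffAt_id, ?_⟩
    refine (contMDiffAt_const (c := ((v, 0) : RVec n × (RVec n →L[ℝ] RVec n)))).congr_of_eventuallyEq
      ?_
    filter_upwards [extChartAt_source_mem_nhds (I := frameModel n) u₀] with u hu
    exact tangentCoordChange_symm hu (mem_extChartAt_source u) (v, 0)
  have h2 := (contMDiffAt_totalSpace.1 ((Γ.smooth _).comp u₀ h1)).2
  have h3 := ((contDiff_snd (𝕜 := ℝ) (E := RVec n)
    (F := RVec n →L[ℝ] RVec n)).contMDiff.contMDiffAt.comp u₀ h2).neg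
  refine h3.congr_of_eventuallyEq ?_
  filter_upwards [extChartAt_source_mem_nhds (I := frameModel n) u₀] with u hu
  exact Γ.jetCoord_horizontalLift hu v

theorem contMDiff_sigmaTilde :
    ContMDiff (frameModel n) (jetFrameModel n) ∞ Γ.sigmaTilde :=
  Γ.contMDiff_horizontalJet.congr Γ.sigmaTilde_eq

theorem pullback_sigmaTilde_jetTautologicalForm :
    pullbackOneForm (frameModel n) (jetFrameModel n) Γ.sigmaTilde jetTautologicalForm =
      FrameBundle.tautologicalForm := by
  rw [funext Γ.sigmaTilde_eq]
  ext u X : 2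
  refine (JetFrame.jetTautologicalForm_mfderiv
    (Γ.contMDiff_horizontalJet.mdifferentiableAt (by simp)) X).trans ?_
  -- The horizontal jet at `u` has base point `u`, so the map differentiated here is the identity.
  exact congrArg (FrameBundle.tautologicalForm u) (DFunLike.congr_fun mfderiv_id X)

end FrameConnection

end JetFrameSmoothness

theorem mainTheorem10 (n : ℕ) (M : Type*) [TopologicalSpace M] [ChartedSpace (RVec n) M]
    [IsManifold (𝓡 n) ∞ M] :
    IsTensorialOneForm 𝓘(ℝ, RVec n →L[ℝ] RVec n) (jetFrameModel n) JetFrame.act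
      (Units.coeHom (RVec n →L[ℝ] RVec n))
      (jetTautologicalForm : ∀ ρ : JetFrame n M, TangentSpace (jetFrameModel n) ρ →L[ℝ] RVec n) ∧
    ∀ Γ : FrameConnection n M,
      ContMDiff (frameModel n) (jetFrameModel n) ∞ Γ.sigmaTilde ∧
      pullbackOneForm (frameModel n) (jetFrameModel n) Γ.sigmaTilde jetTautologicalForm =
        FrameBundle.tautologicalForm :=
  ⟨⟨contMDiff_pullbackOneForm JetFrame.contMDiff_toFrame FrameBundle.contMDiff_tautologicalForm,
    JetFrame.pullback_act_jetTautologicalForm,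
    JetFrame.jetTautologicalForm_orbitMap⟩,
    fun Γ => ⟨Γ.contMDiff_sigmaTilde, Γ.pullback_sigmaTilde_jetTautologicalForm⟩⟩
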